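/- Let $\mathbb{F}_q$ be the finite field with $q$ elements, $\mathbb{F}_{q^m}$ its extension of degree $m$, and let $n\le m$, $k\ge 1$, $w\ge 0$, $\delta\ge 0$ be integers. For $x\in\mathbb{F}_{q^m}^n$ let $\mathrm{rank}(x)$ be the dimension of the $\mathbb{F}_q$-span of the entries of $x$. Let $g_1,\dots,g_n\in\mathbb{F}_{q^m}$ be linearly independent over $\mathbb{F}_q$, and let $Gab_k(g)\subseteq\mathbb{F}_{q^m}^n$ be the Gabidulin code generated over $\mathbb{F}_{q^m}$ by the rows $(g_1^{q^i},\dots,g_n^{q^i})$, $0\le i<k$. Put $\xi:=w-\frac{n-k}{2}$ and assume $2\xi\le\delta\le n-k$. For a full-rank matrix $B\in\mathbb{F}_q^{\delta\times n}$, the error-erasure decoder, applied to $r\in\mathbb{F}_{q^m}^n$ with column erasures $B$, outputs the (necessarily unique) codeword $c\in Gab_k(g)$ such that $r-c=a_CB+a_EB_E$ for some $t\ge 0$ with $2t+\delta\le n-k$, $a_C\in\mathbb{F}_{q^m}^{\delta}$, $a_E\in\mathbb{F}_{q^m}^{t}$ and $B_E\in\mathbb{F}_q^{t\times n}$, if there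 is one, and reports a failure otherwise. Let $r$ be uniformly distributed on $\mathbb{F}_{q^m}^n$ and let $\mathcal{U}$ be, independently, uniformly distributed on the set of $\delta$-dimensional subspaces of $\mathbb{F}_q^n$ (the guess of the error row space). Then the probability that the error-erasure decoder, applied to $r$ with column erasures a basis of $\mathcal{U}$, outputs a codeword $c\in Gab_k(g)$ with $\mathrm{rank}(r-c)\le w$ is at most $$\sum_{j=0}^{w}\bar A_j P_{n,k,\delta,j},$$ and $$\sum_{j=0}^{w}\bar A_j P_{n,k,\delta,j}\le 64\,n\,q^{\,m(k-n)+w(n+m)-w^2-\left\lceil\frac{\delta}{2}+w-\frac{n-k}{2}\right\rceil\left(\frac{n+k}{2}-\left\lceil\frac{\delta}{2}\right\rceil\right)}.$$ Here $$\bar A_j=q^{m(k-n)}\prod_{i=0}^{j-1}\frac{(q^m-q^i)(q^n-q^i)}{q^j-q^i},$$ which for every $j\ge 0$ is the average, over all $r\in\mathbb{F}_{q^m}^n$, of the number of codewords $c\in Gab_k(g)$ with $\mathrm{rank}(r-c)=j$; and, with $\binom{a}{b}_q=\prod_{i=0}^{b-1}\frac{q^a-q^i}{q^b-q^i}$ the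 Gaussian binomial coefficient, $$P_{n,k,\delta,j}=\binom{n}{\delta}_q^{-1}\sum_{i=\lceil j-\frac{n-k}{2}+\frac{\delta}{2}\rceil}^{\min\{\delta,j\}}\binom{n-j}{\delta-i}_q\binom{j}{i}_q\,q^{(j-i)(\delta-i)}$$ if $2j+\delta>n-k$, and $P_{n,k,\delta,j}=1$ otherwise. -/

import Mathlib

namespace GabidulinDecoding

noncomputable section

/-! ### Rank metric and Gabidulin codes -/

section Codes

variable (F : Type*) {L : Type*} [Field F] [Fintype F] [Field L] [Algebra F L]

/-- The `F`-rank of a vector over `L`: the `F`-dimension of the span of its entries. -/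
def rankWeight {n : ℕ} (x : Fin n → L) : ℕ :=
  Module.finrank F (Submodule.span F (Set.range x))

/-- The generator matrix with `(i, j)` entry `g j ^ (q ^ i)`, `0 ≤ i < k`, where `q = |F|`. -/
def gabGenerator {n : ℕ} (k : ℕ) (g : Fin n → L) : Matrix (Fin k) (Fin n) L :=
  Matrix.of fun i j => g j ^ (Fintype.card F ^ (i : ℕ))

/-- The Gabidulin code `Gab_k(g)`: the row space of its generator matrix. -/
def gabCode {n : ℕ} (k : ℕ) (g : Fin n → L) : Submodule L (Fin n → L) :=
  Submodule.span L (Set.range (gabGenerator F k g).row)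

/-- `c` lies within the error-erasure correction radius of `r`, when the rows of `B` are used as
`δ` column erasures and the code has length `n` and dimension `k`: the error `r - c` is
`a_C B + a_E B_E` with unknown `a_C`, `a_E`, `B_E`, where `a_E B_E` accounts for `t` full errors
and `2 t + δ ≤ n - k`. -/
def Correctable {n δ : ℕ} (k : ℕ) (r : Fin n → L) (B : Matrix (Fin δ) (Fin n) F)
    (c : Fin n → L) : Prop :=
  ∃ t : ℕ, 2 * t + δ + k ≤ n ∧
    ∃ (aC : Fin δ → L) (aE : Fin t → L) (BE : Matrix (Fin t) (Fin n) F),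
      r - c = Matrix.vecMul aC (B.map (algebraMap F L)) +
        Matrix.vecMul aE (BE.map (algebraMap F L))

open Classical in
/-- The (bounded-distance) error-erasure decoder of `Gab_k(g)` for the column erasures `B`: it
returns the codeword within the error-erasure correction radius of `r` if there is one (it is then
unique, because the minimum rank distance of the code is `n - k + 1`), and `none` otherwise. -/
def errorErasureDecode {n δ : ℕ} (k : ℕ) (g : Fin n → L) (r : Fin n → L)
    (B : Matrix (Fin δ) (Fin n) F) : Option (Fin n → L) :=
  if h : ∃ c ∈ gabCode F k g, Correctable F k r B c then some h.choose else none

end Codes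

/-! ### Random guesses -/

/-- The set of `δ`-dimensional subspaces of `F ^ n`. -/
abbrev Grass (F : Type*) [Field F] (n δ : ℕ) : Type _ :=
  {U : Submodule F (Fin n → F) // Module.finrank F U = δ}

/-- A full-rank `δ × n` matrix whose row space is `U`. -/
def basisMatrix {F : Type*} [Field F] {n δ : ℕ} (U : Grass F n δ) : Matrix (Fin δ) (Fin n) F :=
  Matrix.of fun i => (Module.finBasisOfFinrankEq F U.1 U.2 i : Fin n → F)

/-- The probability of `E` under the uniform distribution on the finite type `Ω`, all of whose
subsets are events. -/
def uniformProb (Ω : Type*) (E : Set Ω) : ℝ :=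
  letI : MeasurableSpace Ω := ⊤
  (ProbabilityTheory.uniformOn (Set.univ : Set Ω)).real E

/-- The event, on pairs (received word, guess of the error row space), that the error-erasure
decoder run with the guessed space as column erasures outputs a codeword at rank distance at most
`w` from the received word. -/
def successEvent (F : Type*) {L : Type*} [Field F] [Fintype F] [Field L] [Algebra F L]
    {n : ℕ} (k δ w : ℕ) (g : Fin n → L) : Set ((Fin n → L) × Grass F n δ) :=
  {x | ∃ c, errorErasureDecode F k g x.1 (basisMatrix x.2) = some c ∧
    rankWeight F (x.1 - c) ≤ w}

/-- The average, over all received words `r`, of the number of codewords of `Gab_k(g)` at rank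
distance exactly `j` from `r`. -/
def averageCodewords (F : Type*) {L : Type*} [Field F] [Fintype F] [Field L] [Fintype L]
    [Algebra F L] {n : ℕ} (k : ℕ) (g : Fin n → L) (j : ℕ) : ℝ :=
  Finset.expect Finset.univ fun r : Fin n → L =>
    (Set.ncard {c : Fin n → L | c ∈ gabCode F k g ∧ rankWeight F (r - c) = j} : ℝ)

/-! ### The quantities in the bound -/

/-- The Gaussian binomial coefficient: the number of `k`-dimensional subspaces of `F_q ^ n`. -/
def gaussBinom (q n k : ℕ) : ℝ :=
  ∏ i ∈ Finset.range k, ((q : ℝ) ^ n - (q : ℝ) ^ i) / ((q : ℝ) ^ k - (q : ℝ) ^ i)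

/-- `P_{n,k,δ,j}`. -/
def guessProb (q n k δ j : ℕ) : ℝ :=
  if n < 2 * j + δ + k then
    (∑ i ∈ Finset.Icc ⌈(j : ℝ) - ((n : ℝ) - k) / 2 + (δ : ℝ) / 2⌉₊ (min δ j),
      gaussBinom q (n - j) (δ - i) * gaussBinom q j i * (q : ℝ) ^ ((j - i) * (δ - i))) /
      gaussBinom q n δ
  else 1

/-- `Ā_j = q ^ (m (k - n)) ∏_{i < j} (q ^ m - q ^ i) (q ^ n - q ^ i) / (q ^ j - q ^ i)`. -/
def Abar (q m n k j : ℕ) : ℝ :=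
  (q : ℝ) ^ ((m : ℤ) * ((k : ℤ) - n)) *
    ∏ i ∈ Finset.range j,
      ((q : ℝ) ^ m - (q : ℝ) ^ i) * ((q : ℝ) ^ n - (q : ℝ) ^ i) / ((q : ℝ) ^ j - (q : ℝ) ^ i)

/-- The excess `ξ = w - (n - k) / 2` of the error weight over the unique decoding radius. -/
def excess (n k w : ℕ) : ℝ := (w : ℝ) - ((n : ℝ) - k) / 2

end

end GabidulinDecoding

/-!
If the decoder outputs `c`, then the row space of `r - c` meets the guessed space `U` in dimension
at least `j - (n - k) / 2 + δ / 2`, where `j = rank (r - c)`: of the error `a_C B + a_E B_E`, only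
the part outside `U` costs full errors. For a fixed error of rank `j`, this event has probability at
most `P_{n,k,δ,j}` over the choice of `U`, and `Ā_j` is the expected number of codewords at rank
distance `j` from a random word, so the first inequality is a union bound over the code.

Both counts come from sorting the tuples of vectors of an `F`-space by their span: each
`d`-dimensional subspace is spanned by equally many `n`-tuples, and the vectors of `L ^ n` of rank
`j` are exactly the `n`-tuples spanning a `j`-dimensional subspace of `L`.

For the second inequality, `∏ (1 - q ^ (-i)) ≥ 9 / 32` puts a Gaussian binomial coefficient between
`q ^ (k (n - k))` and `32 / 9` times that. The sum defining `P_{n,k,δ,j}` is then dominated by its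
first term, up to a geometric series of ratio `q ^ (-3) ≤ 1 / 8`, and the resulting exponent is
increasing in `j ≤ w`. The constant is `(32 / 9) ^ 3 * (8 / 7) ≤ 64`.
-/

namespace GabidulinDecoding

open Module Submodule

/-! ### Counting subspaces by spanning tuples -/

section Counting

/-- The number of linearly independent `k`-tuples in an `n`-dimensional vector space over a field
with `q` elements; it is the numerator of the Gaussian binomial coefficient `gaussBinom q n k`. -/
noncomputable def indepCount (q n k : ℕ) : ℝ :=
  ∏ i ∈ Finset.range k, ((q : ℝ) ^ n - (q : ℝ) ^ i)

theorem indepCount_eq_zero {q n k : ℕ} (hk : n < k) : indepCount q n k = 0 :=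
  Finset.prod_eq_zero (Finset.mem_range.2 hk) (sub_self _)

theorem indepCount_pos {q n k : ℕ} (hq : 1 < q) (hk : k ≤ n) : 0 < indepCount q n k :=
  Finset.prod_pos fun _ hi ↦ sub_pos.2 <|
    pow_lt_pow_right₀ (mod_cast hq) ((Finset.mem_range.1 hi).trans_le hk)

theorem gaussBinom_eq_div (q n k : ℕ) : gaussBinom q n k = indepCount q n k / indepCount q k k :=
  Finset.prod_div_distrib _ _

theorem gaussBinom_pos {q n k : ℕ} (hq : 1 < q) (hk : k ≤ n) : 0 < gaussBinom q n k := by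
  rw [gaussBinom_eq_div]
  exact div_pos (indepCount_pos hq hk) (indepCount_pos hq le_rfl)

theorem card_subtype_comp_of_surjective {G H : Type*} [AddGroup G] [AddGroup H] [Finite G]
    (f : G →+ H) (hf : Function.Surjective f) (P : H → Prop) :
    Nat.card {x // P (f x)} = Nat.card f.ker * Nat.card {y // P y} := by
  have : Finite H := .of_surjective f hf
  have := Fintype.ofFinite {y // P y}
  have hfiber (y : H) : Nat.card {x // f x = y} = Nat.card f.ker :=
    Nat.card_congr (f.fiberEquivKerOfSurjective hf y)
  rw [← Nat.card_congr (Equiv.sigmaSubtypeFiberEquivSubtype f fun _ ↦ Iff.rfl), Nat.card_sigma,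
    Finset.sum_congr rfl fun y _ ↦ hfiber y.1]
  simp only [Finset.sum_const, Finset.card_univ, smul_eq_mul, mul_comm, Nat.card_eq_fintype_card]

variable {F V : Type*} [Field F] [AddCommGroup V] [Module F V]

theorem finrank_comap_mkQ [FiniteDimensional F V] (W : Submodule F V) (U : Submodule F (V ⧸ W)) :
    finrank F (U.comap W.mkQ) = finrank F U + finrank F W := by
  have hquot : finrank F ((V ⧸ W) ⧸ U) = finrank F (V ⧸ U.comap W.mkQ) := by
    have e := quotientQuotientEquivQuotient W _ (le_comap_mkQ W U)
    rw [map_comap_eq_of_surjective W.mkQ_surjective] at e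
    exact e.finrank_eq
  have := U.finrank_quotient_add_finrank
  have := W.finrank_quotient_add_finrank
  have := (U.comap W.mkQ).finrank_quotient_add_finrank
  omega

theorem linearIndependent_mkQ_comp_iff {ι : Type*} {E : Submodule F V} {t : ι → V} :
    LinearIndependent F (E.mkQ ∘ t) ↔
      LinearIndependent F t ∧ Disjoint (span F (Set.range t)) E := by
  refine ⟨fun h ↦ ⟨h.of_comp, ?_⟩, fun ⟨ht, hE⟩ ↦ ht.map (by rwa [ker_mkQ])⟩
  refine disjoint_def.2 fun x hx hxE ↦ ?_
  obtain ⟨a, rfl⟩ := Finsupp.mem_span_range_iff_exists_finsupp.1 hx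
  have ha : Finsupp.linearCombination F (E.mkQ ∘ t) a = 0 := by
    rw [← LinearMap.map_finsupp_linearCombination]
    exact (Quotient.mk_eq_zero E).2 hxE
  rw [linearIndependent_iff.1 h a ha, Finsupp.sum_zero_index]

theorem span_range_col_eq_top_iff {m n : Type*} [Finite m] [Finite n] (B : Matrix m n F) :
    span F (Set.range B.col) = ⊤ ↔ LinearIndependent F B.row := by
  have := Fintype.ofFinite m
  have := Fintype.ofFinite n
  rw [linearIndependent_iff_card_eq_finrank_span, Set.finrank, ← Matrix.rank_eq_finrank_span_row,
    Matrix.rank_eq_finrank_span_cols, ← finrank_fintype_fun_eq_card F]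
  exact ⟨fun h ↦ by rw [h, finrank_top], fun h ↦ eq_top_of_finrank_eq h.symm⟩

theorem span_range_coe_eq_iff {ι : Type*} {U : Submodule F V} (y : ι → U) :
    span F (Set.range fun i ↦ (y i : V)) = U ↔ span F (Set.range y) = ⊤ := by
  have hspan : span F (Set.range fun i ↦ (y i : V)) = (span F (Set.range y)).map U.subtype := by
    rw [map_span, ← Set.range_comp]
    rfl
  rw [hspan, ← (map_injective_of_injective U.subtype_injective).eq_iff (b := ⊤), map_subtype_top]

theorem comap_mkQ_inf_eq_iff {W E : Submodule F V} (hW : W ≤ E) (U : Submodule F (V ⧸ W)) :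
    U.comap W.mkQ ⊓ E = W ↔ Disjoint U (E.map W.mkQ) := by
  have hE : (E.map W.mkQ).comap W.mkQ = E := by rw [comap_map_mkQ, sup_eq_right.2 hW]
  have hbot : (⊥ : Submodule F (V ⧸ W)).comap W.mkQ = W := W.ker_mkQ
  rw [disjoint_iff, ← (comap_injective_of_surjective W.mkQ_surjective).eq_iff, comap_inf, hE, hbot]

variable [Fintype F] [Finite V]

theorem card_eq_card_pow_finrank : (Nat.card V : ℝ) = (Fintype.card F : ℝ) ^ finrank F V := by
  rw [natCard_eq_pow_finrank (K := F), Nat.card_eq_fintype_card, Nat.cast_pow]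

theorem card_linearIndependent_eq_indepCount (k : ℕ) :
    (Nat.card {s : Fin k → V // LinearIndependent F s} : ℝ) =
      indepCount (Fintype.card F) (finrank F V) k := by
  rcases le_or_gt k (finrank F V) with hk | hk
  · rw [card_linearIndependent hk, Nat.cast_prod, indepCount, ← Fin.prod_univ_eq_prod_range
      (fun i ↦ (Fintype.card F : ℝ) ^ finrank F V - (Fintype.card F : ℝ) ^ i)]
    refine Finset.prod_congr rfl fun i _ ↦ ?_
    rw [Nat.cast_sub (Nat.pow_le_pow_right Fintype.card_pos (i.2.le.trans hk)), Nat.cast_pow,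
      Nat.cast_pow]
  · have : IsEmpty {s : Fin k → V // LinearIndependent F s} :=
      ⟨fun s ↦ hk.not_ge (by simpa using s.2.fintype_card_le_finrank)⟩
    rw [Nat.card_of_isEmpty, indepCount_eq_zero hk, Nat.cast_zero]

theorem card_span_range_eq_top (ι : Type*) [Fintype ι] :
    (Nat.card {x : ι → V // span F (Set.range x) = ⊤} : ℝ) =
      indepCount (Fintype.card F) (Fintype.card ι) (finrank F V) := by
  let b := finBasis F V
  let rows : (ι → V) ≃ (Fin (finrank F V) → ι → F) :=
    (Equiv.piCongrRight fun _ ↦ b.equivFun.toEquiv).trans (Equiv.piComm _)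
  have hrows (x : ι → V) :
      span F (Set.range x) = ⊤ ↔ LinearIndependent F (rows x) := by
    refine .trans ?_ (span_range_col_eq_top_iff (Matrix.of (rows x)))
    have hcol : (Matrix.of (rows x)).col = b.equivFun ∘ x := rfl
    rw [hcol, Set.range_comp, ← LinearEquiv.coe_coe, span_image,
      LinearMap.map_eq_top_iff b.equivFun.range, LinearEquiv.ker, sup_bot_eq]
  rw [Nat.card_congr (rows.subtypeEquiv (q := fun r ↦ LinearIndependent F r) hrows),
    card_linearIndependent_eq_indepCount, finrank_fintype_fun_eq_card]

theorem card_subtype_span_range {ι : Type*} [Fintype ι] {P : Submodule F V → Prop} {d : ℕ}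
    (hP : ∀ U, P U → finrank F U = d) :
    (Nat.card {x : ι → V // P (span F (Set.range x))} : ℝ) =
      Nat.card {U // P U} * indepCount (Fintype.card F) (Fintype.card ι) d := by
  have hfiber (U : {U // P U}) :
      (Nat.card {x : ι → V // span F (Set.range x) = U.1} : ℝ) =
        indepCount (Fintype.card F) (Fintype.card ι) d := by
    rw [← hP U.1 U.2, ← card_span_range_eq_top (V := U.1) ι]
    refine congrArg _ (Nat.card_congr
      { toFun x := ⟨fun i ↦ ⟨x.1 i, x.2.le (subset_span ⟨i, rfl⟩)⟩, (span_range_coe_eq_iff _).1 x.2⟩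
        invFun y := ⟨fun i ↦ y.1 i, (span_range_coe_eq_iff _).2 y.2⟩ })
  have := Fintype.ofFinite {U // P U}
  rw [← Nat.card_congr (Equiv.sigmaSubtypeFiberEquivSubtype (fun x : ι → V ↦ span F (Set.range x))
      fun _ ↦ Iff.rfl), Nat.card_sigma,
    Nat.cast_sum, Finset.sum_congr rfl fun U _ ↦ hfiber U]
  simp

theorem card_subspaces (d : ℕ) :
    (Nat.card {U : Submodule F V // finrank F U = d} : ℝ) =
      gaussBinom (Fintype.card F) (finrank F V) d := by
  have htuples := card_subtype_span_range (V := V) (ι := Fin d)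
    (P := fun U ↦ finrank F U = d) fun _ ↦ id
  have hind (s : Fin d → V) : finrank F (span F (Set.range s)) = d ↔ LinearIndependent F s := by
    rw [linearIndependent_iff_card_eq_finrank_span, Fintype.card_fin, eq_comm, Set.finrank]
  simp only [hind, Fintype.card_fin] at htuples
  rw [card_linearIndependent_eq_indepCount] at htuples
  rw [gaussBinom_eq_div, htuples,
    mul_div_cancel_right₀ _ (indepCount_pos Fintype.one_lt_card le_rfl).ne']

theorem card_subspaces_disjoint (E : Submodule F V) (d : ℕ) :
    (Nat.card {U : Submodule F V // finrank F U = d ∧ Disjoint U E} : ℝ) =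
      (Fintype.card F : ℝ) ^ (finrank F E * d) *
        gaussBinom (Fintype.card F) (finrank F V - finrank F E) d := by
  have htuples := card_subtype_span_range (V := V) (ι := Fin d)
    (P := fun U ↦ finrank F U = d ∧ Disjoint U E) fun _ ↦ And.left
  have hind (s : Fin d → V) : finrank F (span F (Set.range s)) = d ∧
      Disjoint (span F (Set.range s)) E ↔ LinearIndependent F (E.mkQ ∘ s) := by
    rw [linearIndependent_mkQ_comp_iff, linearIndependent_iff_card_eq_finrank_span,
      Fintype.card_fin, eq_comm, Set.finrank]
  have hlift := card_subtype_comp_of_surjective (E.mkQ.compLeft (Fin d)).toAddMonoidHom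
    (E.mkQ_surjective.comp_left) (fun t ↦ LinearIndependent F t)
  have hker : (Nat.card (E.mkQ.compLeft (Fin d)).toAddMonoidHom.ker : ℝ) =
      (Fintype.card F : ℝ) ^ (finrank F E * d) := by
    have hrank := (E.mkQ.compLeft (Fin d)).finrank_range_add_finrank_ker
    have hE := E.finrank_quotient_add_finrank
    rw [LinearMap.range_eq_top.2 E.mkQ_surjective.comp_left, finrank_top, finrank_pi_fintype,
      finrank_pi_fintype, Finset.sum_const, Finset.sum_const, ← hE, smul_add] at hrank
    have hker : finrank F (E.mkQ.compLeft (Fin d)).ker = finrank F E * d := by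
      simpa [mul_comm] using Nat.add_left_cancel hrank
    rw [← hker, ← card_eq_card_pow_finrank]
    rfl
  have : Finite (V ⧸ E) := .of_surjective _ E.mkQ_surjective
  simp only [hind, Fintype.card_fin] at htuples
  rw [gaussBinom_eq_div, ← mul_div_assoc, eq_div_iff
    (indepCount_pos Fintype.one_lt_card le_rfl).ne', ← htuples, ← finrank_quotient,
    ← card_linearIndependent_eq_indepCount, ← hker]
  exact_mod_cast hlift

theorem card_subspaces_inf_eq {W E : Submodule F V} (hW : W ≤ E) (d : ℕ) :
    (Nat.card {U : Submodule F V // finrank F U = finrank F W + d ∧ U ⊓ E = W} : ℝ) =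
      (Fintype.card F : ℝ) ^ ((finrank F E - finrank F W) * d) *
        gaussBinom (Fintype.card F) (finrank F V - finrank F E) d := by
  have hle (U : Submodule F V) (hU : finrank F U = finrank F W + d ∧ U ⊓ E = W) : U ∈ Set.Ici W :=
    hU.2.ge.trans inf_le_left
  have hcomap (U : Submodule F (V ⧸ W)) : finrank F U = d ∧ Disjoint U (E.map W.mkQ) ↔
      finrank F (U.comap W.mkQ) = finrank F W + d ∧ U.comap W.mkQ ⊓ E = W := by
    rw [finrank_comap_mkQ, add_comm, Nat.add_left_cancel_iff, comap_mkQ_inf_eq_iff hW]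
  let quotientEquiv : {U : Submodule F (V ⧸ W) // finrank F U = d ∧ Disjoint U (E.map W.mkQ)} ≃
      {U : Submodule F V // finrank F U = finrank F W + d ∧ U ⊓ E = W} :=
    (W.comapMkQRelIso.toEquiv.subtypeEquiv hcomap).trans (Equiv.subtypeSubtypeEquivSubtype (hle _))
  have : Finite (V ⧸ W) := .of_surjective _ W.mkQ_surjective
  have hE : finrank F (E.map W.mkQ) = finrank F E - finrank F W := by
    have := finrank_comap_mkQ W (E.map W.mkQ)
    rw [comap_map_mkQ, sup_eq_right.2 hW] at this
    omega
  have hV := W.finrank_quotient_add_finrank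
  have := finrank_mono hW
  rw [← Nat.card_congr quotientEquiv, card_subspaces_disjoint, hE]
  congr 2
  omega

theorem card_subspaces_le (E : Submodule F V) (i : ℕ) :
    (Nat.card {W : Submodule F V // W ≤ E ∧ finrank F W = i} : ℝ) =
      gaussBinom (Fintype.card F) (finrank F E) i := by
  let subtypeEquiv : {W : Submodule F E // finrank F W = i} ≃
      {W : Submodule F V // W ≤ E ∧ finrank F W = i} :=
    ((MapSubtype.orderIso E).toEquiv.subtypeEquiv (q := fun W ↦ finrank F W.1 = i) fun W ↦
      (finrank_map_subtype_eq E W).congr_left.symm).trans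
      (Equiv.subtypeSubtypeEquivSubtypeInter (fun W ↦ W ≤ E) fun W ↦ finrank F W = i)
  rw [← Nat.card_congr subtypeEquiv, card_subspaces]

theorem card_subspaces_finrank_inf (E : Submodule F V) (i d : ℕ) :
    (Nat.card {U : Submodule F V // finrank F U = i + d ∧ finrank F ↥(U ⊓ E) = i} : ℝ) =
      gaussBinom (Fintype.card F) (finrank F E) i *
        ((Fintype.card F : ℝ) ^ ((finrank F E - i) * d) *
          gaussBinom (Fintype.card F) (finrank F V - finrank F E) d) := by
  let fiberEquiv : (Σ W : {W : Submodule F V // W ≤ E ∧ finrank F W = i},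
      {U : Submodule F V // finrank F U = i + d ∧ U ⊓ E = W}) ≃
      {U : Submodule F V // finrank F U = i + d ∧ finrank F ↥(U ⊓ E) = i} :=
    { toFun p := ⟨p.2.1, p.2.2.1, by rw [p.2.2.2, p.1.2.2]⟩
      invFun U := ⟨⟨U.1 ⊓ E, inf_le_right, U.2.2⟩, U.1, U.2.1, rfl⟩
      left_inv := by
        rintro ⟨⟨W, hW⟩, ⟨U, hU, hUW⟩⟩
        obtain rfl : U ⊓ E = W := hUW
        rfl }
  have hfiber (W : {W : Submodule F V // W ≤ E ∧ finrank F W = i}) :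
      (Nat.card {U : Submodule F V // finrank F U = i + d ∧ U ⊓ E = W} : ℝ) =
        (Fintype.card F : ℝ) ^ ((finrank F E - i) * d) *
          gaussBinom (Fintype.card F) (finrank F V - finrank F E) d := by
    simpa only [W.2.2] using card_subspaces_inf_eq W.2.1 d
  have := Fintype.ofFinite {W : Submodule F V // W ≤ E ∧ finrank F W = i}
  rw [← Nat.card_congr fiberEquiv, Nat.card_sigma, Nat.cast_sum, ← card_subspaces_le]
  simp only [hfiber, Finset.sum_const, Finset.card_univ, nsmul_eq_mul, Nat.card_eq_fintype_card]

theorem ncard_grass_finrank_inf_eq {n δ i : ℕ} (E : Submodule F (Fin n → F)) (hi : i ≤ δ) :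
    ({U : Grass F n δ | finrank F ↥(U.1 ⊓ E) = i}.ncard : ℝ) =
      gaussBinom (Fintype.card F) (n - finrank F E) (δ - i) *
        gaussBinom (Fintype.card F) (finrank F E) i *
          (Fintype.card F : ℝ) ^ ((finrank F E - i) * (δ - i)) := by
  obtain ⟨d, rfl⟩ := Nat.exists_eq_add_of_le hi
  rw [← Nat.card_coe_set_eq, Set.coe_ofPred, Nat.card_congr (Equiv.subtypeSubtypeEquivSubtypeInter
    (fun U : Submodule F (Fin n → F) ↦ finrank F U = i + d) fun U ↦ finrank F ↥(U ⊓ E) = i),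
    card_subspaces_finrank_inf, finrank_fin_fun, Nat.add_sub_cancel_left]
  ring

end Counting

/-! ### Gabidulin codes and row spaces of errors -/

section Code

variable {F L : Type*} [Field F] [Fintype F] [Field L] [Algebra F L]

-- A nonzero `q`-polynomial of `q`-degree less than `n` has fewer than `q ^ n` roots, but its roots
-- form an `F`-subspace.
theorem eq_zero_of_sum_mul_pow_card_pow_eq_zero {n k : ℕ} {g : Fin n → L}
    (hg : LinearIndependent F g) (hk : k ≤ n) {a : Fin k → L}
    (ha : ∀ c, ∑ i : Fin k, a i * g c ^ Fintype.card F ^ (i : ℕ) = 0) : a = 0 := by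
  classical
  have hq : 1 < Fintype.card F := Fintype.one_lt_card
  let T : L →ₗ[F] L := ∑ i : Fin k, a i • (FiniteField.frobeniusAlgHom F L ^ (i : ℕ)).toLinearMap
  let P : Polynomial L := ∑ i : Fin k, Polynomial.monomial (Fintype.card F ^ (i : ℕ)) (a i)
  have hT (y : L) : T y = ∑ i : Fin k, a i * y ^ Fintype.card F ^ (i : ℕ) := by
    simp [T, AlgHom.coe_pow, FiniteField.coe_frobeniusAlgHom, pow_iterate]
  have hPT (y : L) : P.eval y = T y := by simp [P, hT, Polynomial.eval_finsetSum]
  have hroot (b : Fin n → F) : P.eval (Fintype.linearCombination F g b) = 0 := by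
    simp [hPT, Fintype.linearCombination_apply, hT (g _), ha]
  have hdeg : P.degree < (Finset.univ : Finset (Fin n → F)).card := by
    rw [Finset.card_univ, Fintype.card_fun, Fintype.card_fin, ← Polynomial.mem_degreeLT]
    refine sum_mem fun i _ ↦ Polynomial.mem_degreeLT.2 ?_
    exact (Polynomial.degree_monomial_le _ _).trans_lt
      (mod_cast Nat.pow_lt_pow_right hq (i.2.trans_le hk))
  have hP : P = 0 := Polynomial.eq_zero_of_degree_lt_of_eval_index_eq_zero _
    hg.fintypeLinearCombination_injective.injOn hdeg fun b _ ↦ hroot b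
  funext i
  simpa [P, Polynomial.finsetSum_coeff, Polynomial.coeff_monomial,
    (Nat.pow_right_injective hq).eq_iff, Fin.val_inj] using
    congrArg (Polynomial.coeff · (Fintype.card F ^ (i : ℕ))) hP

theorem linearIndependent_gabGenerator_row {n k : ℕ} {g : Fin n → L}
    (hg : LinearIndependent F g) (hk : k ≤ n) : LinearIndependent L (gabGenerator F k g).row := by
  refine Fintype.linearIndependent_iff.2 fun a ha ↦ congrFun ?_
  refine eq_zero_of_sum_mul_pow_card_pow_eq_zero hg hk fun c ↦ ?_
  simpa [gabGenerator, Matrix.row] using congrFun ha c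

theorem card_gabCode [Finite L] {n k : ℕ} {g : Fin n → L} (hg : LinearIndependent F g)
    (hk : k ≤ n) :
    (Nat.card (gabCode F k g) : ℝ) = (Fintype.card F : ℝ) ^ (finrank F L * k) := by
  have := Fintype.ofFinite L
  rw [card_eq_card_pow_finrank (F := L), gabCode,
    finrank_span_eq_card (linearIndependent_gabGenerator_row hg hk), Fintype.card_fin, pow_mul,
    ← card_eq_card_pow_finrank, Nat.card_eq_fintype_card]

theorem exists_correctable_of_mem_successEvent {n k δ w : ℕ} {g : Fin n → L}
    {x : (Fin n → L) × Grass F n δ} (hx : x ∈ successEvent F k δ w g) :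
    ∃ c ∈ gabCode F k g, rankWeight F (x.1 - c) ≤ w ∧
      Correctable F k (x.1 - c) (basisMatrix x.2) 0 := by
  obtain ⟨c, hdec, hw⟩ := hx
  rw [errorErasureDecode] at hdec
  split_ifs at hdec with h
  obtain ⟨hc, hcorr⟩ := h.choose_spec
  rw [Option.some.inj hdec] at hc hcorr
  exact ⟨c, hc, hw, by simpa only [Correctable, sub_zero] using hcorr⟩

end Code

section RowSpace

variable {F L : Type*} [Field F] [Field L] [Algebra F L] {n : ℕ}

/-- The row space over `F` of a vector over `L`, that is, of the matrix whose columns are the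
coordinates of its entries in a basis of `L`. It is encoded without a basis: the rows are replaced
by the images of the vector under all `F`-linear functionals on `L`. -/
def rowSpace (F : Type*) {L : Type*} [Field F] [Field L] [Algebra F L] {n : ℕ} (x : Fin n → L) :
    Submodule F (Fin n → F) :=
  LinearMap.range (LinearMap.pi fun c ↦ Dual.eval F L (x c))

theorem finrank_rowSpace [FiniteDimensional F L] (x : Fin n → L) :
    finrank F (rowSpace F x) = rankWeight F x := by
  have hker : (LinearMap.pi fun c ↦ Dual.eval F L (x c)).ker =
      (span F (Set.range x)).dualAnnihilator := by
    ext φ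
    rw [LinearMap.mem_ker, funext_iff, mem_dualAnnihilator]
    change (∀ c, φ (x c) = 0) ↔ span F (Set.range x) ≤ φ.ker
    rw [span_le, Set.range_subset_iff]
    rfl
  have hrank := (LinearMap.pi fun c ↦ Dual.eval F L (x c)).finrank_range_add_finrank_ker
  rw [hker, Subspace.dual_finrank_eq] at hrank
  have hann := Subspace.finrank_add_finrank_dualAnnihilator_eq (span F (Set.range x))
  rw [rowSpace, rankWeight]
  omega

theorem rowSpace_add_le (x y : Fin n → L) : rowSpace F (x + y) ≤ rowSpace F x ⊔ rowSpace F y := by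
  rintro _ ⟨φ, rfl⟩
  refine mem_sup.2 ⟨_, ⟨φ, rfl⟩, _, ⟨φ, rfl⟩, ?_⟩
  ext c
  simp

theorem rowSpace_vecMul_map_le {m : ℕ} (a : Fin m → L) (B : Matrix (Fin m) (Fin n) F) :
    rowSpace F (Matrix.vecMul a (B.map (algebraMap F L))) ≤ span F (Set.range B.row) := by
  rintro _ ⟨φ, rfl⟩
  have hφ : (LinearMap.pi fun c ↦ Dual.eval F L (Matrix.vecMul a (B.map (algebraMap F L)) c)) φ =
      ∑ i, φ (a i) • B.row i := by
    ext c
    have hentry : Matrix.vecMul a (B.map (algebraMap F L)) c = ∑ i, B i c • a i := by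
      simp [Matrix.vecMul, dotProduct, Algebra.smul_def, mul_comm]
    simp [hentry, mul_comm]
  rw [hφ]
  exact sum_mem fun i _ ↦ smul_mem _ _ (subset_span ⟨i, rfl⟩)

theorem Correctable.le_finrank_inf [FiniteDimensional F L] {δ k : ℕ} {r c : Fin n → L}
    {B : Matrix (Fin δ) (Fin n) F} (h : Correctable F k r B c) :
    2 * rankWeight F (r - c) + δ + k ≤
      n + 2 * finrank F ↥(span F (Set.range B.row) ⊓ rowSpace F (r - c)) := by
  obtain ⟨t, ht, aC, aE, BE, he⟩ := h
  set U := span F (Set.range B.row)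
  set E := rowSpace F (r - c) with hE
  have hle : E ≤ U ⊔ span F (Set.range BE.row) := by
    rw [hE, he]
    exact (rowSpace_add_le _ _).trans
      (sup_le_sup (rowSpace_vecMul_map_le _ _) (rowSpace_vecMul_map_le _ _))
  have hBE : finrank F (span F (Set.range BE.row)) ≤ t :=
    (finrank_range_le_card BE.row).trans_eq (Fintype.card_fin t)
  have hmono := finrank_mono (sup_le le_sup_left hle : U ⊔ E ≤ _)
  have hinf := finrank_sup_add_finrank_inf_eq U E
  have hadd := finrank_add_le_finrank_add_finrank U (span F (Set.range BE.row))
  rw [← finrank_rowSpace, ← hE]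
  omega

theorem span_range_row_basisMatrix {δ : ℕ} (U : Grass F n δ) :
    span F (Set.range (basisMatrix U).row) = U.1 := by
  let b := finBasisOfFinrankEq F U.1 U.2
  have hb : span F (Set.range fun i ↦ (b i : Fin n → F)) = U.1 :=
    (span_range_coe_eq_iff b).2 b.span_eq
  exact hb

theorem ncard_correctable_le_sum [Finite F] [FiniteDimensional F L] {δ k : ℕ} (e : Fin n → L) :
    {U : Grass F n δ | Correctable F k e (basisMatrix U) 0}.ncard ≤
      ∑ i ∈ Finset.Icc ⌈(rankWeight F e : ℝ) - ((n : ℝ) - k) / 2 + (δ : ℝ) / 2⌉₊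
        (min δ (rankWeight F e)),
        {U : Grass F n δ | finrank F ↥(U.1 ⊓ rowSpace F e) = i}.ncard := by
  refine (Set.ncard_le_ncard fun U hU ↦ ?_).trans (Finset.set_ncard_biUnion_le _ _)
  refine Set.mem_biUnion (Finset.mem_Icc.2 ⟨?_, le_min ?_ ?_⟩) rfl
  · have hinf := hU.le_finrank_inf
    rw [sub_zero, span_range_row_basisMatrix] at hinf
    rw [Nat.ceil_le]
    have : (2 * rankWeight F e + δ + k : ℝ) ≤ n + 2 * finrank F ↥(U.1 ⊓ rowSpace F e) :=
      mod_cast hinf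
    linarith
  · exact (finrank_mono inf_le_left).trans_eq U.2
  · exact (finrank_mono inf_le_right).trans_eq (finrank_rowSpace e)

end RowSpace

/-! ### The union bound -/

section DoubleCounting

theorem sum_ncard_sub_mem {G : Type*} [AddGroup G] [Fintype G] (C S : Set G) :
    ∑ r : G, {c | c ∈ C ∧ r - c ∈ S}.ncard = C.ncard * S.ncard := by
  classical
  have htranslate (c : G) : {r | r - c ∈ S}.ncard = S.ncard :=
    Set.ncard_preimage_of_injective_subset_range sub_left_injective fun s _ ↦ ⟨s + c, by simp⟩
  calc ∑ r : G, {c | c ∈ C ∧ r - c ∈ S}.ncard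
      = ∑ r : G, (C.toFinset.filter fun c ↦ r - c ∈ S).card := by
        simp only [Set.ncard_eq_toFinset_card']
        congr! 2
        ext
        simp
    _ = ∑ c ∈ C.toFinset, {r | r - c ∈ S}.ncard := by
        simp only [Set.ncard_eq_toFinset_card', Set.toFinset_ofPred]
        exact Finset.sum_card_bipartiteAbove_eq_sum_card_bipartiteBelow _
    _ = C.ncard * S.ncard := by
        simp only [htranslate, Finset.sum_const, smul_eq_mul, ← Set.ncard_eq_toFinset_card']

theorem ncard_exists_sub_mem_le {G β : Type*} [AddGroup G] [Finite G] [Finite β] (C : Set G)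
    (S : Set (G × β)) :
    {x : G × β | ∃ c ∈ C, (x.1 - c, x.2) ∈ S}.ncard ≤ C.ncard * S.ncard := by
  rw [← Set.ncard_prod]
  refine (Set.ncard_le_ncard ?_).trans (Set.ncard_image_le (s := C ×ˢ S)
    (f := fun p ↦ (p.2.1 + p.1, p.2.2)))
  rintro x ⟨c, hc, hx⟩
  exact ⟨(c, _), ⟨hc, hx⟩, by simp⟩

theorem ncard_fiber_le_mul {α β : Type*} [Finite α] [Finite β] {f : α → ℕ} {b : ℕ → ℝ}
    {R : α → β → Prop} (hR : ∀ a, ({y | R a y}.ncard : ℝ) ≤ b (f a)) (j : ℕ) :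
    ({x : α × β | f x.1 = j ∧ R x.1 x.2}.ncard : ℝ) ≤ {a | f a = j}.ncard * b j := by
  classical
  have := Fintype.ofFinite α
  let A := {a | f a = j}.toFinset
  have hcover : {x : α × β | f x.1 = j ∧ R x.1 x.2} ⊆ ⋃ a ∈ A, Prod.mk a '' {y | R a y} :=
    fun x hx ↦ Set.mem_biUnion (Set.mem_toFinset.2 hx.1) ⟨x.2, hx.2, rfl⟩
  calc ({x : α × β | f x.1 = j ∧ R x.1 x.2}.ncard : ℝ)
      ≤ ∑ a ∈ A, ((Prod.mk a '' {y | R a y}).ncard : ℝ) := by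
        exact_mod_cast (Set.ncard_le_ncard hcover).trans (A.set_ncard_biUnion_le _)
    _ ≤ ∑ _a ∈ A, b j := Finset.sum_le_sum fun a ha ↦ by
        rw [← Set.mem_toFinset.1 ha, Set.ncard_image_of_injective _ (Prod.mk_right_injective a)]
        exact hR a
    _ = {a | f a = j}.ncard * b j := by
        rw [Finset.sum_const, nsmul_eq_mul, Set.ncard_eq_toFinset_card']

theorem ncard_le_sum_ncard_fiber_mul {α β : Type*} [Finite α] [Finite β] {f : α → ℕ} {b : ℕ → ℝ}
    {R : α → β → Prop} (hR : ∀ a, ({y | R a y}.ncard : ℝ) ≤ b (f a)) (w : ℕ) :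
    ({x : α × β | f x.1 ≤ w ∧ R x.1 x.2}.ncard : ℝ) ≤
      ∑ j ∈ Finset.range (w + 1), {a | f a = j}.ncard * b j := by
  have hcover : {x : α × β | f x.1 ≤ w ∧ R x.1 x.2} ⊆
      ⋃ j ∈ Finset.range (w + 1), {x : α × β | f x.1 = j ∧ R x.1 x.2} :=
    fun x hx ↦ Set.mem_biUnion (Finset.mem_range_succ_iff.2 hx.1) ⟨rfl, hx.2⟩
  refine le_trans ?_ (Finset.sum_le_sum fun j _ ↦ ncard_fiber_le_mul hR j)
  exact_mod_cast (Set.ncard_le_ncard hcover).trans (Finset.set_ncard_biUnion_le _ _)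

theorem uniformProb_eq (Ω : Type*) [Finite Ω] (E : Set Ω) :
    uniformProb Ω E = E.ncard / Nat.card Ω := by
  have := Fintype.ofFinite Ω
  let _ : MeasurableSpace Ω := ⊤
  rw [uniformProb, MeasureTheory.measureReal_def, ProbabilityTheory.uniformOn_univ,
    MeasureTheory.Measure.count_apply_finite _ E.toFinite]
  simp [← Set.ncard_eq_toFinset_card E]

end DoubleCounting

section Probability

variable {F L : Type*} [Field F] [Fintype F] [Field L] [Algebra F L] {n k δ : ℕ}

theorem ncard_rankWeight_eq [Finite L] (n j : ℕ) :
    ({x : Fin n → L | rankWeight F x = j}.ncard : ℝ) =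
      gaussBinom (Fintype.card F) (finrank F L) j * indepCount (Fintype.card F) n j := by
  rw [← card_subspaces, ← Nat.card_coe_set_eq]
  exact (card_subtype_span_range (P := fun U ↦ finrank F U = j) fun _ ↦ id).trans
    (by rw [Fintype.card_fin])

theorem Abar_eq_mul (q m n k j : ℕ) :
    Abar q m n k j = (q : ℝ) ^ ((m : ℤ) * ((k : ℤ) - n)) *
      (gaussBinom q m j * indepCount q n j) := by
  rw [Abar, gaussBinom, indepCount, ← Finset.prod_mul_distrib]
  simp only [div_mul_eq_mul_div]

theorem card_mul_ncard_rankWeight_eq [Finite L] {g : Fin n → L} (hg : LinearIndependent F g)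
    (hk : k ≤ n) (j : ℕ) :
    (Nat.card (gabCode F k g) : ℝ) * {x : Fin n → L | rankWeight F x = j}.ncard =
      Abar (Fintype.card F) (finrank F L) n k j * Nat.card (Fin n → L) := by
  have hq : (Fintype.card F : ℝ) ≠ 0 := Nat.cast_ne_zero.2 Fintype.card_ne_zero
  rw [ncard_rankWeight_eq, card_gabCode hg hk, Abar_eq_mul, card_eq_card_pow_finrank (F := F)
    (V := Fin n → L), finrank_pi_fintype, mul_right_comm, ← zpow_natCast, ← zpow_natCast,
    ← zpow_add₀ hq]
  congr 2
  simp
  ring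

theorem averageCodewords_eq [Fintype L] {g : Fin n → L} (hg : LinearIndependent F g)
    (hk : k ≤ n) (j : ℕ) :
    averageCodewords F k g j = Abar (Fintype.card F) (finrank F L) n k j := by
  have hcard : (Nat.card (Fin n → L) : ℝ) ≠ 0 := Nat.cast_ne_zero.2 Nat.card_pos.ne'
  rw [← mul_left_inj' hcard, ← card_mul_ncard_rankWeight_eq hg hk, averageCodewords,
    Finset.expect_eq_sum_div_card, Finset.card_univ, ← Nat.card_eq_fintype_card,
    div_mul_cancel₀ _ hcard]
  exact_mod_cast sum_ncard_sub_mem (gabCode F k g : Set (Fin n → L)) {x | rankWeight F x = j}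

theorem ncard_correctable_le [Finite L] (hδ : δ ≤ n) (e : Fin n → L) :
    ({U : Grass F n δ | Correctable F k e (basisMatrix U) 0}.ncard : ℝ) ≤
      guessProb (Fintype.card F) n k δ (rankWeight F e) * Nat.card (Grass F n δ) := by
  rw [guessProb]
  split_ifs with h
  · rw [card_subspaces, finrank_fin_fun,
      div_mul_cancel₀ _ (gaussBinom_pos Fintype.one_lt_card hδ).ne']
    refine (Nat.cast_le.2 (ncard_correctable_le_sum e)).trans_eq ?_
    rw [Nat.cast_sum]
    refine Finset.sum_congr rfl fun i hi ↦ ?_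
    rw [ncard_grass_finrank_inf_eq _ (le_min_iff.1 (Finset.mem_Icc.1 hi).2).1, finrank_rowSpace]
  · rw [one_mul, ← Set.ncard_univ]
    exact Nat.cast_le.2 (Set.ncard_le_ncard (Set.subset_univ _))

theorem uniformProb_successEvent_le [Finite L] (w : ℕ) {g : Fin n → L} (hg : LinearIndependent F g)
    (hk : k ≤ n) (hδ : δ ≤ n) :
    uniformProb ((Fin n → L) × Grass F n δ) (successEvent F k δ w g) ≤
      ∑ j ∈ Finset.range (w + 1),
        Abar (Fintype.card F) (finrank F L) n k j * guessProb (Fintype.card F) n k δ j := by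
  let S : Set ((Fin n → L) × Grass F n δ) :=
    {x | rankWeight F x.1 ≤ w ∧ Correctable F k x.1 (basisMatrix x.2) 0}
  have hunion : (successEvent F k δ w g).ncard ≤ Nat.card (gabCode F k g) * S.ncard :=
    (Set.ncard_le_ncard fun _ ↦ exists_correctable_of_mem_successEvent).trans
      (ncard_exists_sub_mem_le _ S)
  have hS := ncard_le_sum_ncard_fiber_mul (f := rankWeight F)
    (b := fun j ↦ guessProb (Fintype.card F) n k δ j * Nat.card (Grass F n δ))
    (ncard_correctable_le (F := F) (L := L) (k := k) hδ) w
  have hG : (0 : ℝ) < Nat.card (Grass F n δ) := by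
    rw [card_subspaces, finrank_fin_fun]
    exact gaussBinom_pos Fintype.one_lt_card hδ
  rw [uniformProb_eq, Nat.card_prod, Nat.cast_mul,
    div_le_iff₀ (mul_pos (Nat.cast_pos.2 Nat.card_pos) hG)]
  calc ((successEvent F k δ w g).ncard : ℝ)
      ≤ Nat.card (gabCode F k g) * S.ncard := mod_cast hunion
    _ ≤ _ := mul_le_mul_of_nonneg_left hS (Nat.cast_nonneg _)
    _ = _ := by
      rw [Finset.mul_sum, Finset.sum_mul]
      refine Finset.sum_congr rfl fun j _ ↦ ?_
      rw [← mul_assoc, card_mul_ncard_rankWeight_eq hg hk]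
      ring

end Probability

/-! ### Estimates of the counts -/

section Estimates

-- The limit of the product is about `0.2888 > 9 / 32`; the error term, which vanishes in the limit,
-- makes the bound provable by induction.
theorem le_prod_one_sub_half_pow (k : ℕ) :
    9 / 32 + 3 / 8 * (1 / 2 : ℝ) ^ (k + 2) ≤
      ∏ i ∈ Finset.range (k + 2), (1 - (1 / 2) ^ (i + 1)) := by
  induction k with
  | zero => norm_num [Finset.prod_range_succ]
  | succ k ih =>
    have ht : (1 / 2 : ℝ) ^ (k + 2) ≤ 1 / 4 :=
      (pow_le_pow_of_le_one (by norm_num) (by norm_num) (Nat.le_add_left 2 k)).trans_eq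
        (by norm_num)
    have ht0 : (0 : ℝ) < (1 / 2) ^ (k + 2) := by positivity
    rw [Finset.prod_range_succ, Nat.add_right_comm k 1 2, pow_succ _ (k + 2)]
    refine le_trans ?_ (mul_le_mul_of_nonneg_right ih (by linarith))
    nlinarith [mul_nonneg ht0.le (sub_nonneg.2 ht)]

theorem nine_div_thirtytwo_le_prod_one_sub_pow {x : ℝ} (hx0 : 0 ≤ x) (hx : x ≤ 1 / 2) (k : ℕ) :
    9 / 32 ≤ ∏ i ∈ Finset.range k, (1 - x ^ (i + 1)) := by
  have hfactor (i : ℕ) : (1 : ℝ) - (1 / 2) ^ (i + 1) ≤ 1 - x ^ (i + 1) :=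
    sub_le_sub_left (pow_le_pow_left₀ hx0 hx _) 1
  have hhalf (i : ℕ) : (0 : ℝ) ≤ 1 - (1 / 2) ^ (i + 1) :=
    sub_nonneg.2 (pow_le_one₀ (by norm_num) (by norm_num))
  calc (9 / 32 : ℝ) ≤ ∏ i ∈ Finset.range (k + 2), (1 - (1 / 2 : ℝ) ^ (i + 1)) :=
        (le_add_of_nonneg_right (by positivity)).trans (le_prod_one_sub_half_pow k)
    _ ≤ ∏ i ∈ Finset.range k, (1 - (1 / 2 : ℝ) ^ (i + 1)) :=
        Finset.prod_le_prod_of_subset_of_le_one (Finset.range_mono (Nat.le_add_right k 2))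
          (fun i _ ↦ hhalf i) fun i _ _ ↦ sub_le_self 1 (by positivity)
    _ ≤ ∏ i ∈ Finset.range k, (1 - x ^ (i + 1)) :=
        Finset.prod_le_prod (fun i _ ↦ hhalf i) fun i _ ↦ hfactor i

variable {q : ℕ}

theorem indepCount_le (hq : 1 < q) {n k : ℕ} (hk : k ≤ n) :
    indepCount q n k ≤ (q : ℝ) ^ (n * k) := by
  have hq' : (1 : ℝ) ≤ q := mod_cast hq.le
  calc indepCount q n k ≤ ∏ _i ∈ Finset.range k, (q : ℝ) ^ n :=
        Finset.prod_le_prod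
          (fun i hi ↦ sub_nonneg.2 (pow_le_pow_right₀ hq' ((Finset.mem_range.1 hi).le.trans hk)))
          fun i _ ↦ sub_le_self _ (by positivity)
    _ = (q : ℝ) ^ (n * k) := by rw [Finset.prod_const, Finset.card_range, pow_mul]

theorem inv_le_half (hq : 1 < q) : (q : ℝ)⁻¹ ≤ 1 / 2 := by
  rw [one_div]
  exact inv_anti₀ two_pos (mod_cast hq)

theorem indepCount_self_eq (hq : 1 < q) (k : ℕ) :
    indepCount q k k = (∏ i ∈ Finset.range k, (1 - (q : ℝ)⁻¹ ^ (i + 1))) * (q : ℝ) ^ (k * k) := by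
  have hq0 : (q : ℝ) ≠ 0 := by positivity
  have hfactor {i : ℕ} (hi : i < k) :
      (q : ℝ) ^ k - (q : ℝ) ^ i = (1 - (q : ℝ)⁻¹ ^ (k - 1 - i + 1)) * (q : ℝ) ^ k := by
    obtain ⟨d, rfl⟩ := Nat.exists_eq_add_of_lt hi
    rw [show i + d + 1 - 1 - i = d by omega, inv_pow, sub_mul, one_mul, add_assoc, pow_add,
      mul_left_comm, inv_mul_cancel₀ (pow_ne_zero _ hq0), mul_one]
  rw [indepCount, ← Finset.prod_range_reflect (fun i ↦ 1 - (q : ℝ)⁻¹ ^ (i + 1)), pow_mul,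
    Finset.prod_congr rfl fun i hi ↦ hfactor (Finset.mem_range.1 hi), Finset.prod_mul_distrib,
    Finset.prod_const, Finset.card_range]

theorem le_indepCount_self (hq : 1 < q) (k : ℕ) :
    9 / 32 * (q : ℝ) ^ (k * k) ≤ indepCount q k k := by
  rw [indepCount_self_eq hq]
  gcongr
  exact nine_div_thirtytwo_le_prod_one_sub_pow (by positivity) (inv_le_half hq) k

theorem gaussBinom_le (hq : 1 < q) (k d : ℕ) :
    gaussBinom q (k + d) k ≤ 32 / 9 * (q : ℝ) ^ (k * d) := by
  rw [gaussBinom_eq_div, div_le_iff₀ (indepCount_pos hq le_rfl)]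
  calc indepCount q (k + d) k ≤ (q : ℝ) ^ ((k + d) * k) := indepCount_le hq (Nat.le_add_right k d)
    _ = 32 / 9 * (q : ℝ) ^ (k * d) * (9 / 32 * (q : ℝ) ^ (k * k)) := by ring
    _ ≤ _ := by gcongr; exact le_indepCount_self hq k

theorem le_gaussBinom (hq : 1 < q) (k d : ℕ) : (q : ℝ) ^ (k * d) ≤ gaussBinom q (k + d) k := by
  have hq' : (1 : ℝ) < q := mod_cast hq
  calc (q : ℝ) ^ (k * d) = ∏ _i ∈ Finset.range k, (q : ℝ) ^ d := by
        rw [Finset.prod_const, Finset.card_range, mul_comm, pow_mul]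
    _ ≤ gaussBinom q (k + d) k := by
        refine Finset.prod_le_prod (fun i _ ↦ by positivity) fun i hi ↦ ?_
        rw [le_div_iff₀ (sub_pos.2 (pow_lt_pow_right₀ hq' (Finset.mem_range.1 hi))), mul_sub,
          ← pow_add, ← pow_add, add_comm d k]
        exact sub_le_sub_left (pow_le_pow_right₀ hq'.le (Nat.le_add_left i d)) _

theorem gaussBinom_mul_gaussBinom_mul_pow_le (hq : 1 < q) (i a b e : ℕ) :
    gaussBinom q (a + e) a * gaussBinom q (i + b) i * (q : ℝ) ^ (b * a) ≤
      (32 / 9) ^ 2 * (q : ℝ)⁻¹ ^ (i * e) * gaussBinom q (i + a + (b + e)) (i + a) := by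
  have hq0 : (q : ℝ) ≠ 0 := by positivity
  have hexp : (q : ℝ) ^ (a * e) * (q : ℝ) ^ (i * b) * (q : ℝ) ^ (b * a) =
      (q : ℝ)⁻¹ ^ (i * e) * (q : ℝ) ^ ((i + a) * (b + e)) := by
    rw [inv_pow, eq_inv_mul_iff_mul_eq₀ (pow_ne_zero _ hq0)]
    ring
  calc gaussBinom q (a + e) a * gaussBinom q (i + b) i * (q : ℝ) ^ (b * a)
      ≤ 32 / 9 * (q : ℝ) ^ (a * e) * (32 / 9 * (q : ℝ) ^ (i * b)) * (q : ℝ) ^ (b * a) := by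
        have := (gaussBinom_pos hq (Nat.le_add_right i b)).le
        gcongr <;> exact gaussBinom_le hq _ _
    _ = (32 / 9) ^ 2 * ((q : ℝ)⁻¹ ^ (i * e) * (q : ℝ) ^ ((i + a) * (b + e))) := by
        rw [← hexp]
        ring
    _ ≤ (32 / 9) ^ 2 * (q : ℝ)⁻¹ ^ (i * e) * gaussBinom q (i + a + (b + e)) (i + a) := by
        rw [← mul_assoc]
        gcongr
        exact le_gaussBinom hq _ _

theorem sum_pow_add_mul_add_le {x : ℝ} (hx0 : 0 ≤ x) (hx : x ≤ 1 / 2) {a c : ℕ} (ha : 1 ≤ a)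
    (hc : 1 ≤ c) (N : ℕ) :
    ∑ s ∈ Finset.range N, x ^ ((a + s) * (c + s)) ≤ 8 / 7 * x ^ (a * c) := by
  have hx3 : x ^ 3 ≤ 1 / 8 := (pow_le_pow_left₀ hx0 hx 3).trans_eq (by norm_num)
  have hgeom : ∑ s ∈ Finset.range N, (x ^ 3) ^ s ≤ 8 / 7 := by
    calc ∑ s ∈ Finset.range N, (x ^ 3) ^ s ≤ ∑ s ∈ Finset.range N, (1 / 8 : ℝ) ^ s := by gcongr
      _ = 8 / 7 - 8 / 7 * (1 / 8) ^ N := by rw [geom_sum_eq (by norm_num)]; ring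
      _ ≤ 8 / 7 := sub_le_self _ (by positivity)
  calc ∑ s ∈ Finset.range N, x ^ ((a + s) * (c + s))
      ≤ ∑ s ∈ Finset.range N, (x ^ 3) ^ s * x ^ (a * c) := by
        refine Finset.sum_le_sum fun s _ ↦ ?_
        rw [← pow_mul, ← pow_add]
        refine pow_le_pow_of_le_one hx0 (by linarith) ?_
        nlinarith [Nat.le_mul_self s, Nat.mul_le_mul_right s ha, Nat.mul_le_mul_right s hc]
    _ ≤ 8 / 7 * x ^ (a * c) := by
        rw [← Finset.sum_mul]
        gcongr

end Estimates

section GuessBounds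

/-- The exponent `⌈δ / 2 + j - (n - k) / 2⌉ * ((n + k) / 2 - ⌈δ / 2⌉)` of the decay of `P_{n,k,δ,j}`
in `q`. -/
noncomputable def guessExponent (n k δ j : ℕ) : ℝ :=
  (⌈(δ : ℝ) / 2 + j - ((n : ℝ) - k) / 2⌉ : ℝ) * (((n : ℝ) + k) / 2 - (⌈(δ : ℝ) / 2⌉ : ℝ))

variable {q m n k δ j w : ℕ}

theorem le_add_two_mul_ceil (n k δ j : ℕ) :
    2 * j + δ + k ≤ n + 2 * ⌈(j : ℝ) - ((n : ℝ) - k) / 2 + (δ : ℝ) / 2⌉₊ := by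
  have hceil := Nat.le_ceil ((j : ℝ) - ((n : ℝ) - k) / 2 + (δ : ℝ) / 2)
  rify
  linarith

theorem guessProb_summand_le (hq : 1 < q) {i : ℕ} (hiδ : i ≤ δ) (hij : i ≤ j) (hn : δ + j ≤ n + i) :
    gaussBinom q (n - j) (δ - i) * gaussBinom q j i * (q : ℝ) ^ ((j - i) * (δ - i)) ≤
      (32 / 9) ^ 2 * (q : ℝ)⁻¹ ^ (i * (n - j + i - δ)) * gaussBinom q n δ := by
  obtain ⟨a, rfl⟩ := Nat.exists_eq_add_of_le hiδ
  obtain ⟨b, rfl⟩ := Nat.exists_eq_add_of_le hij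
  obtain ⟨e, rfl⟩ : ∃ e, n = i + a + (b + e) := ⟨n - (i + a + b), by omega⟩
  have hn' : i + a + (b + e) - (i + b) = a + e := by omega
  have he : a + e + i - (i + a) = e := by omega
  simpa only [hn', he, Nat.add_sub_cancel_left] using
    gaussBinom_mul_gaussBinom_mul_pow_le hq i a b e

theorem guessProb_le_of_lt (hq : 1 < q) (hk : 1 ≤ k) (hδ : δ + k ≤ n)
    (hlt : n < 2 * j + δ + k) {a : ℕ} (ha : ⌈(j : ℝ) - ((n : ℝ) - k) / 2 + (δ : ℝ) / 2⌉₊ = a) :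
    guessProb q n k δ j ≤ (32 / 9) ^ 2 * (8 / 7) * (q : ℝ)⁻¹ ^ (a * (n - j + a - δ)) := by
  have hceil := le_add_two_mul_ceil n k δ j
  have hδ0 := gaussBinom_pos hq (Nat.le_of_add_right_le hδ)
  rw [guessProb, if_pos hlt, div_le_iff₀ hδ0]
  rw [ha] at hceil ⊢
  calc ∑ i ∈ Finset.Icc a (min δ j),
        gaussBinom q (n - j) (δ - i) * gaussBinom q j i * (q : ℝ) ^ ((j - i) * (δ - i))
      ≤ ∑ i ∈ Finset.Icc a (min δ j),
          (32 / 9) ^ 2 * (q : ℝ)⁻¹ ^ (i * (n - j + i - δ)) * gaussBinom q n δ := by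
        refine Finset.sum_le_sum fun i hi ↦ ?_
        rw [Finset.mem_Icc, le_min_iff] at hi
        exact guessProb_summand_le hq hi.2.1 hi.2.2 (by omega)
    _ = (32 / 9) ^ 2 * (∑ s ∈ Finset.range (min δ j + 1 - a),
          (q : ℝ)⁻¹ ^ ((a + s) * (n - j + a - δ + s))) * gaussBinom q n δ := by
        rw [← Finset.sum_mul, ← Finset.mul_sum, ← Finset.Ico_add_one_right_eq_Icc,
          Finset.sum_Ico_eq_sum_range]
        congr! 5
        omega
    _ ≤ (32 / 9) ^ 2 * (8 / 7 * (q : ℝ)⁻¹ ^ (a * (n - j + a - δ))) * gaussBinom q n δ := by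
        gcongr
        exact sum_pow_add_mul_add_le (by positivity) (inv_le_half hq) (by omega) (by omega) _
    _ = _ := by ring

theorem guessExponent_le_mul (hj : j ≤ n) (hlt : n < 2 * j + δ + k) {a : ℕ} (hδ : δ + k ≤ n)
    (ha : ⌈(j : ℝ) - ((n : ℝ) - k) / 2 + (δ : ℝ) / 2⌉₊ = a) :
    guessExponent n k δ j ≤ (a * (n - j + a - δ) : ℕ) := by
  have hceil := le_add_two_mul_ceil n k δ j
  rw [ha] at hceil
  have harg : (δ : ℝ) / 2 + j - ((n : ℝ) - k) / 2 = j - ((n : ℝ) - k) / 2 + δ / 2 := by ring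
  have hpos : 0 ≤ (j : ℝ) - ((n : ℝ) - k) / 2 + δ / 2 := by
    rify at hlt
    linarith
  rw [guessExponent, harg, ← natCast_ceil_eq_intCast_ceil hpos, ha, Nat.cast_mul,
    Nat.cast_sub (by omega), Nat.cast_add, Nat.cast_sub hj]
  refine mul_le_mul_of_nonneg_left ?_ (Nat.cast_nonneg a)
  have := Int.le_ceil ((δ : ℝ) / 2)
  rify at hceil
  linarith

theorem guessExponent_nonpos (hk : 1 ≤ k) (hle : 2 * j + δ + k ≤ n) :
    guessExponent n k δ j ≤ 0 := by
  rify at hk hle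
  have := (Nat.cast_nonneg j : (0 : ℝ) ≤ j)
  have := Int.ceil_lt_add_one ((δ : ℝ) / 2)
  refine mul_nonpos_of_nonpos_of_nonneg (Int.cast_nonpos.2 (Int.ceil_le.2 ?_)) (by linarith)
  rw [Int.cast_zero]
  linarith

theorem guessProb_le (hq : 1 < q) (hk : 1 ≤ k) (hj : j ≤ n) (hδ : δ + k ≤ n) :
    guessProb q n k δ j ≤ (32 / 9) ^ 2 * (8 / 7) * (q : ℝ) ^ (-guessExponent n k δ j) := by
  have hq1 : (1 : ℝ) ≤ q := mod_cast hq.le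
  rcases lt_or_ge n (2 * j + δ + k) with hlt | hge
  · refine (guessProb_le_of_lt hq hk hδ hlt rfl).trans ?_
    rw [inv_pow, ← Real.rpow_natCast _ (_ * _), ← Real.rpow_neg (Nat.cast_nonneg q)]
    gcongr
    exact guessExponent_le_mul hj hlt hδ rfl
  · rw [guessProb, if_neg hge.not_gt]
    have := Real.one_le_rpow hq1 (neg_nonneg.2 (guessExponent_nonpos hk hge))
    linarith

theorem Abar_nonneg (hq : 1 < q) (k : ℕ) (hjm : j ≤ m) (hjn : j ≤ n) : 0 ≤ Abar q m n k j := by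
  rw [Abar_eq_mul]
  have := gaussBinom_pos hq hjm
  have := indepCount_pos hq hjn
  positivity

theorem Abar_le (hq : 1 < q) (k : ℕ) (hjm : j ≤ m) (hjn : j ≤ n) :
    Abar q m n k j ≤
      32 / 9 * (q : ℝ) ^ ((m : ℝ) * ((k : ℝ) - n) + (j : ℝ) * ((n : ℝ) + m) - (j : ℝ) ^ 2) := by
  obtain ⟨d, rfl⟩ := Nat.exists_eq_add_of_le hjm
  have hq0 : (0 : ℝ) < q := by positivity
  have hexp : (q : ℝ) ^ (((j + d : ℕ) : ℝ) * ((k : ℝ) - n) + (j : ℝ) * ((n : ℝ) + (j + d : ℕ)) -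
      (j : ℝ) ^ 2) = (q : ℝ) ^ (((j + d : ℕ) : ℤ) * ((k : ℤ) - n)) *
        ((q : ℝ) ^ (j * d) * (q : ℝ) ^ (n * j)) := by
    rw [← pow_add, ← Real.rpow_intCast, ← Real.rpow_natCast _ (_ + _), ← Real.rpow_add hq0]
    congr 1
    push_cast
    ring
  rw [Abar_eq_mul, hexp, mul_left_comm (32 / 9), ← mul_assoc (32 / 9)]
  have := (indepCount_pos hq hjn).le
  gcongr
  · exact gaussBinom_le hq j d
  · exact indepCount_le hq hjn

theorem sub_guessExponent_mono (hnm : n ≤ m) (hδ : δ + k ≤ n) (hw : 2 * w + k ≤ n + δ)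
    (hjw : j ≤ w) :
    (j : ℝ) * ((n : ℝ) + m) - (j : ℝ) ^ 2 - guessExponent n k δ j ≤
      (w : ℝ) * ((n : ℝ) + m) - (w : ℝ) ^ 2 - guessExponent n k δ w := by
  have hceil (l : ℕ) : (⌈(δ : ℝ) / 2 + l - ((n : ℝ) - k) / 2⌉ : ℝ) =
      ⌈(δ : ℝ) / 2 - ((n : ℝ) - k) / 2⌉ + l := by
    rw [add_sub_right_comm, Int.ceil_add_natCast, Int.cast_add, Int.cast_natCast]
  rw [guessExponent, guessExponent, hceil, hceil]
  have hδ2 := Int.le_ceil ((δ : ℝ) / 2)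
  rify at hnm hδ hw hjw
  have hslope : 0 ≤ (n : ℝ) + m - (w + j) - ((n + k) / 2 - ⌈(δ : ℝ) / 2⌉) := by linarith
  linarith [mul_nonneg (sub_nonneg.2 hjw) hslope]

theorem Abar_mul_guessProb_le (hq : 1 < q) (hk : 1 ≤ k) (hjm : j ≤ m) (hjn : j ≤ n)
    (hδ : δ + k ≤ n) :
    Abar q m n k j * guessProb q n k δ j ≤ 64 * (q : ℝ) ^ ((m : ℝ) * ((k : ℝ) - n) +
      (j : ℝ) * ((n : ℝ) + m) - (j : ℝ) ^ 2 - guessExponent n k δ j) := by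
  have hq0 : (0 : ℝ) < q := by positivity
  refine (mul_le_mul_of_nonneg (Abar_le hq k hjm hjn) (guessProb_le hq hk hjn hδ)
    (Abar_nonneg hq k hjm hjn) (by positivity)).trans ?_
  rw [mul_mul_mul_comm, ← Real.rpow_add hq0, ← sub_eq_add_neg]
  gcongr
  norm_num

theorem sum_Abar_mul_guessProb_le (hq : 1 < q) (hk : 1 ≤ k) (hnm : n ≤ m) (hδ : δ + k ≤ n)
    (hw : 2 * w + k ≤ n + δ) :
    ∑ j ∈ Finset.range (w + 1), Abar q m n k j * guessProb q n k δ j ≤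
      64 * (n : ℝ) * (q : ℝ) ^ ((m : ℝ) * ((k : ℝ) - n) + (w : ℝ) * ((n : ℝ) + m) - (w : ℝ) ^ 2 -
        guessExponent n k δ w) := by
  have hq1 : (1 : ℝ) ≤ q := mod_cast hq.le
  set top : ℝ := (m : ℝ) * ((k : ℝ) - n) + (w : ℝ) * ((n : ℝ) + m) - (w : ℝ) ^ 2 -
    guessExponent n k δ w
  have hterm : ∀ j ∈ Finset.range (w + 1), Abar q m n k j * guessProb q n k δ j ≤
      64 * (q : ℝ) ^ top := fun j hj ↦ by
    have hjw := Finset.mem_range_succ_iff.1 hj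
    refine (Abar_mul_guessProb_le hq hk (by omega) (by omega) hδ).trans ?_
    gcongr 64 * (q : ℝ) ^ ?_
    linarith [sub_guessExponent_mono hnm hδ hw hjw]
  have hwn : ((w + 1 : ℕ) : ℝ) ≤ n := by exact_mod_cast (by omega : w + 1 ≤ n)
  calc ∑ j ∈ Finset.range (w + 1), Abar q m n k j * guessProb q n k δ j
      ≤ ((w + 1 : ℕ) : ℝ) * (64 * (q : ℝ) ^ top) := by
        simpa using Finset.sum_le_card_nsmul _ _ _ hterm
    _ ≤ n * (64 * (q : ℝ) ^ top) := by gcongr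
    _ = 64 * n * (q : ℝ) ^ top := by ring

end GuessBounds

end GabidulinDecoding

theorem lemma3 {F L : Type*} [Field F] [Fintype F] [Field L] [Fintype L] [Algebra F L]
    (q m n k w δ : ℕ) (hq : Fintype.card F = q) (hm : Module.finrank F L = m) (hk : 1 ≤ k)
    (g : Fin n → L) (hg : LinearIndependent F g)
    (hδ₁ : 2 * GabidulinDecoding.excess n k w ≤ (δ : ℝ)) (hδ₂ : (δ : ℝ) ≤ (n : ℝ) - k) :
    GabidulinDecoding.uniformProb ((Fin n → L) × GabidulinDecoding.Grass F n δ)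
        (GabidulinDecoding.successEvent F k δ w g) ≤
      ∑ j ∈ Finset.range (w + 1),
        GabidulinDecoding.Abar q m n k j * GabidulinDecoding.guessProb q n k δ j ∧
    ∑ j ∈ Finset.range (w + 1),
        GabidulinDecoding.Abar q m n k j * GabidulinDecoding.guessProb q n k δ j ≤
      64 * (n : ℝ) * (q : ℝ) ^
        ((m : ℝ) * ((k : ℝ) - n) + (w : ℝ) * ((n : ℝ) + m) - (w : ℝ) ^ 2 -
          (⌈(δ : ℝ) / 2 + w - ((n : ℝ) - k) / 2⌉ : ℝ) *
            (((n : ℝ) + k) / 2 - (⌈(δ : ℝ) / 2⌉ : ℝ))) ∧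
    ∀ j : ℕ, GabidulinDecoding.averageCodewords F k g j = GabidulinDecoding.Abar q m n k j := by
  subst hq hm
  have hδk : δ + k ≤ n := by
    rify
    linarith
  have hw : 2 * w + k ≤ n + δ := by
    rw [GabidulinDecoding.excess] at hδ₁
    rify
    linarith
  have hnm : n ≤ Module.finrank F L := by simpa using hg.fintype_card_le_finrank
  have hkn : k ≤ n := by omega
  exact ⟨GabidulinDecoding.uniformProb_successEvent_le w hg hkn (by omega),
    GabidulinDecoding.sum_Abar_mul_guessProb_le Fintype.one_lt_card hk hnm hδk hw,
    GabidulinDecoding.averageCodewords_eq hg hkn⟩
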